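/- Let $0<L_1\le L_2$, $L=L_1+L_2$, and suppose that $L_1/L$ is irrational. Consider the boundary value problems $$(P_\pm)\qquad -u''-u^3=\omega u \text{ on } [0,L],\quad \omega<0,\quad u\in H^2([0,L]),\ u(0)=u(L),\ u'(0)=u'(L),\quad u(0)=\pm u(L_1)=\sqrt{2|\omega|}.$$ Let $K(k)=\int_0^1\frac{dt}{\sqrt{(1-t^2)(1-k^2t^2)}}$ be the complete elliptic integral of the first kind, $\mathrm{cn}(\cdot\,;k)$ the Jacobi elliptic cosine of modulus $k$, and $S(k)=4\sqrt{2k^2-1}\,K(k)$ for $k\in(1/\sqrt2,1)$, an increasing bijection onto $(0,\infty)$. For integers $n\ge1$ put $r_n=\frac{L_1}{L}n-\left\lfloor\frac{L_1}{L}n+\frac12\right\rfloor$, $s_n^+=\frac{L}{2n}r_n$, $s_n^-=\frac{L}{2n}\left(|r_n|-\frac12\right)\mathrm{sgn}(r_n)$. For every $n\ge 1$ and each choice of the sign there is exactly one $\omega=\omega_n^\pm<0$ such that $\omega$ together with the function $$u_n^\pm(x)=\sqrt{\frac{2|\omega|k^2}{2k^2-1}}\ \mathrm{cn}\left(\sqrt{\frac{|\omega|}{2k^2-1}}\,(x-s_n^\pm);k\right),\qquad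 k=S^{-1}\left(\frac{L\sqrt{|\omega|}}{n}\right),$$ solves $(P_\pm)$. Both frequency sequences $\{\omega_n^+\}_{n\ge1}$ and $\{\omega_n^-\}_{n\ge1}$ are unbounded below, and each of them has at least one finite cluster point (limit of a subsequence) lying, respectively, in $$I^+=\left[-\frac{1}{L^2}K\left(\tfrac1{\sqrt2}\right)^4,\,0\right]\qquad\text{and}\qquad I^-=\left[-\frac{16}{5L^2}K\left(\tfrac1{\sqrt2}\right)^4,\,0\right].$$ -/

import Mathlib

open Set Filter Topology MeasureTheory

noncomputable section

/-- Legendre's incomplete elliptic integral of the first kind,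
`F(θ; k) = ∫₀^θ ds / √(1 - k² sin² s)`. -/
def ellipticF (k θ : ℝ) : ℝ :=
  ∫ s in (0 : ℝ)..θ, 1 / √(1 - k ^ 2 * Real.sin s ^ 2)

/-- The complete elliptic integral of the first kind, `K(k) = F(π/2; k)`.  The substitution
`t = sin s` turns it into `∫₀¹ dt / √((1 - t²)(1 - k² t²))`. -/
def ellipticK (k : ℝ) : ℝ := ellipticF k (Real.pi / 2)

/-- The Jacobi amplitude `am(·; k)`: the inverse of the increasing bijection
`F(·; k) : ℝ → ℝ`, for `0 ≤ k < 1`. -/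
def jacobiAm (k y : ℝ) : ℝ := Function.invFun (ellipticF k) y

/-- The Jacobi elliptic cosine `cn(y; k) = cos (am(y; k))`. -/
def jacobiCn (k y : ℝ) : ℝ := Real.cos (jacobiAm k y)

/-- The function `S(k) = 4 √(2k² - 1) K(k)`, considered on `(1/√2, 1)`. -/
def periodS (k : ℝ) : ℝ := 4 * √(2 * k ^ 2 - 1) * ellipticK k

/-- `u` belongs to `H²([0, L])` (continuous representative), with first derivative `v` and second
weak derivative `w ∈ L²`: both `u` and `v` are absolutely continuous on `[0, L]`, being
primitives of `v` and of `w`. -/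
structure IsH2 (L : ℝ) (u v w : ℝ → ℝ) : Prop where
  memLp : MemLp w 2 (volume.restrict (Icc 0 L))
  deriv_eq : ∀ x ∈ Icc 0 L, v x = v 0 + ∫ t in (0 : ℝ)..x, w t
  eq : ∀ x ∈ Icc 0 L, u x = u 0 + ∫ t in (0 : ℝ)..x, v t

/-- `(ω, u)` solves the boundary value problem `(P_σ)`, where `σ = 1` or `σ = -1`:
`-u'' - u³ = ω u` on `[0, L]`, `u ∈ H²_per([0, L])`, `ω < 0`, and
`u(0) = σ u(L₁) = √(2|ω|)`. -/
def SolvesP (σ L L₁ ω : ℝ) (u : ℝ → ℝ) : Prop :=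
  ω < 0 ∧
  (∃ v w : ℝ → ℝ, IsH2 L u v w ∧ u 0 = u L ∧ v 0 = v L ∧
    ∀ᵐ x ∂(volume.restrict (Icc 0 L)), -w x - u x ^ 3 = ω * u x) ∧
  u 0 = σ * u L₁ ∧ σ * u L₁ = √(2 * |ω|)

/-- The modulus `k = S⁻¹(L √|ω| / n) ∈ (1/√2, 1)`. -/
def modulus (L : ℝ) (n : ℕ+) (ω : ℝ) : ℝ :=
  Function.invFunOn periodS (Ioo (1 / √2) 1) (L * √|ω| / (n : ℝ))

/-- The cnoidal wave of frequency `ω` and period `L / n` with a maximum point at `s`: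
`x ↦ √(2|ω|k² / (2k² - 1)) cn(√(|ω| / (2k² - 1)) (x - s); k)` with `k = S⁻¹(L √|ω| / n)`. -/
def cnoidal (L : ℝ) (n : ℕ+) (ω s x : ℝ) : ℝ :=
  √(2 * |ω| * modulus L n ω ^ 2 / (2 * modulus L n ω ^ 2 - 1)) *
    jacobiCn (modulus L n ω) (√(|ω| / (2 * modulus L n ω ^ 2 - 1)) * (x - s))

/-- `r_n = (L₁/L) n - [(L₁/L) n + 1/2]`, with `[·]` the integer part. -/
def rSeq (L L₁ : ℝ) (n : ℕ+) : ℝ :=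
  L₁ / L * (n : ℝ) - (⌊L₁ / L * (n : ℝ) + 1 / 2⌋ : ℝ)

/-- The translation `s_n⁺ = (L / 2n) r_n`. -/
def shiftPlus (L L₁ : ℝ) (n : ℕ+) : ℝ := L / (2 * (n : ℝ)) * rSeq L L₁ n

/-- The translation `s_n⁻ = (L / 2n) (|r_n| - 1/2) sgn(r_n)`. -/
def shiftMinus (L L₁ : ℝ) (n : ℕ+) : ℝ :=
  L / (2 * (n : ℝ)) * (|rSeq L L₁ n| - 1 / 2) * Real.sign (rSeq L L₁ n)

/-- `ω` is an `n`-th frequency of `(P₊)`: together with the cnoidal wave of period `L / n`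
translated by `s_n⁺`, it solves `(P₊)`. -/
def IsFrequencyPlus (L L₁ : ℝ) (n : ℕ+) (ω : ℝ) : Prop :=
  SolvesP 1 L L₁ ω (cnoidal L n ω (shiftPlus L L₁ n))

/-- `ω` is an `n`-th frequency of `(P₋)`: together with the cnoidal wave of period `L / n`
translated by `s_n⁻`, it solves `(P₋)`. -/
def IsFrequencyMinus (L L₁ : ℝ) (n : ℕ+) (ω : ℝ) : Prop :=
  SolvesP (-1) L L₁ ω (cnoidal L n ω (shiftMinus L L₁ n))

end

/-!
The cnoidal wave with period `L / n` is even about its maximum point `s` and antiperiodic with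
antiperiod `L / 2n`; the translations `s_n^±` are chosen so that these symmetries give
`u(0) = ± u(L₁)` for every `ω < 0`. What remains is `u(0) = √(2|ω|)`, that is,
`cn(θ K(k); k) = √(2k² - 1) / k` with `θ = 2|r_n|` for `(P₊)` and `θ = 1 - 2|r_n|` for `(P₋)`.
With `cos φ = √(2k² - 1) / k` this reads `F(φ; k) / K(k) = θ`. The left-hand side decreases
strictly from `1` to `0` on `(1/√2, 1)`, because `F(φ; k)` is nonincreasing and `K` strictly
increasing; so there is exactly one `k`, and `ω = -(n S(k) / L)²`.

The cluster points come from Diophantine approximation of `ξ = L₁ / L`. Where `θ` stays away from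
`1`, `S(k)` is bounded below and `ω → -∞`; where `n (1 - θ) ≤ C` infinitely often, the bound
`S(k) ≤ 4 k² K(k)² (1 - θ)` and `k → 1/√2` give a cluster point of `ω` above
`-(2 C K(1/√2)² / L)²`. The theorem of Hurwitz makes `n |r_n| ≤ 1/√5` infinitely often, and
approximating `ξ` by fractions `p / 2n` with `p` odd and `2n |2nξ - p| ≤ 1` makes
`n (1 - 2|r_n|) ≤ 1/2` infinitely often. Each of the two serves one sign as `θ → 0` and the other
as `θ → 1`.
-/

section EllipticFunctions

open Real

variable {k : ℝ}

lemma one_sub_sq_mul_sin_sq_pos (hk : k ^ 2 < 1) (s : ℝ) : 0 < 1 - k ^ 2 * sin s ^ 2 := by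
  have := mul_le_of_le_one_right (sq_nonneg k) (sin_sq_le_one s)
  linarith

lemma continuous_ellipticF_integrand (hk : k ^ 2 < 1) :
    Continuous fun s => 1 / √(1 - k ^ 2 * sin s ^ 2) :=
  Continuous.div (by fun_prop) (by fun_prop)
    fun s => (sqrt_pos.2 (one_sub_sq_mul_sin_sq_pos hk s)).ne'

lemma intervalIntegrable_ellipticF_integrand (hk : k ^ 2 < 1) (a b : ℝ) :
    IntervalIntegrable (fun s => 1 / √(1 - k ^ 2 * sin s ^ 2)) volume a b :=
  (continuous_ellipticF_integrand hk).intervalIntegrable a b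

lemma hasDerivAt_ellipticF (hk : k ^ 2 < 1) (θ : ℝ) :
    HasDerivAt (ellipticF k) (1 / √(1 - k ^ 2 * sin θ ^ 2)) θ :=
  ((continuous_ellipticF_integrand hk).integral_hasStrictDerivAt 0 θ).hasDerivAt

lemma continuous_ellipticF (hk : k ^ 2 < 1) : Continuous (ellipticF k) :=
  continuous_iff_continuousAt.2 fun θ => (hasDerivAt_ellipticF hk θ).continuousAt

lemma strictMono_ellipticF (hk : k ^ 2 < 1) : StrictMono (ellipticF k) := by
  refine strictMono_of_deriv_pos fun θ => ?_
  rw [(hasDerivAt_ellipticF hk θ).deriv]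
  exact one_div_pos.2 (sqrt_pos.2 (one_sub_sq_mul_sin_sq_pos hk θ))

@[simp] lemma ellipticF_zero (k : ℝ) : ellipticF k 0 = 0 := intervalIntegral.integral_same

lemma ellipticF_neg (k θ : ℝ) : ellipticF k (-θ) = -ellipticF k θ := by
  have := intervalIntegral.integral_comp_neg (a := 0) (b := θ)
    (fun s => 1 / √(1 - k ^ 2 * sin s ^ 2))
  simp only [sin_neg, neg_sq, neg_zero] at this
  rw [ellipticF, ellipticF, intervalIntegral.integral_symm, this]

lemma ellipticF_sub_ellipticF (hk : k ^ 2 < 1) (a b : ℝ) :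
    ellipticF k b - ellipticF k a = ∫ s in a..b, 1 / √(1 - k ^ 2 * sin s ^ 2) :=
  intervalIntegral.integral_interval_sub_left (intervalIntegrable_ellipticF_integrand hk 0 b)
    (intervalIntegrable_ellipticF_integrand hk 0 a)

lemma ellipticF_add_pi (hk : k ^ 2 < 1) (θ : ℝ) :
    ellipticF k (θ + π) = ellipticF k θ + 2 * ellipticK k := by
  have hper : Function.Periodic (fun s => 1 / √(1 - k ^ 2 * sin s ^ 2)) π := fun s => by
    simp only [sin_add_pi, neg_sq]
  have hint := ellipticF_sub_ellipticF hk θ (θ + π)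
  rw [hper.intervalIntegral_add_eq θ (-(π / 2)), ← ellipticF_sub_ellipticF hk,
    show -(π / 2) + π = π / 2 by ring, ellipticF_neg] at hint
  rw [ellipticK]
  linarith

lemma le_ellipticF {θ : ℝ} (hk : k ^ 2 < 1) (hθ : 0 ≤ θ) : θ ≤ ellipticF k θ := by
  have : ∫ _ in (0 : ℝ)..θ, (1 : ℝ) ≤ ellipticF k θ := by
    refine intervalIntegral.integral_mono_on hθ (by simp)
      (intervalIntegrable_ellipticF_integrand hk _ _) fun s _ => ?_
    rw [le_div_iff₀ (sqrt_pos.2 (one_sub_sq_mul_sin_sq_pos hk s)), one_mul, sqrt_le_one]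
    exact sub_le_self _ (by positivity)
  simpa using this

lemma surjective_ellipticF (hk : k ^ 2 < 1) : Function.Surjective (ellipticF k) := by
  have htop : Tendsto (ellipticF k) atTop atTop :=
    tendsto_atTop_mono' _ ((eventually_ge_atTop 0).mono fun θ => le_ellipticF hk) tendsto_id
  refine (continuous_ellipticF hk).surjective htop ?_
  have hodd : ellipticF k = fun θ => -ellipticF k (-θ) := by
    funext θ
    rw [ellipticF_neg, neg_neg]
  rw [hodd]
  exact tendsto_neg_atTop_atBot.comp (htop.comp tendsto_neg_atBot_atTop)

lemma ellipticF_jacobiAm (hk : k ^ 2 < 1) (y : ℝ) : ellipticF k (jacobiAm k y) = y :=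
  Function.invFun_eq (surjective_ellipticF hk y)

lemma jacobiAm_ellipticF (hk : k ^ 2 < 1) (θ : ℝ) : jacobiAm k (ellipticF k θ) = θ :=
  Function.leftInverse_invFun (strictMono_ellipticF hk).injective θ

lemma strictMono_jacobiAm (hk : k ^ 2 < 1) : StrictMono (jacobiAm k) := fun x y h => by
  rwa [← (strictMono_ellipticF hk).lt_iff_lt, ellipticF_jacobiAm hk, ellipticF_jacobiAm hk]

lemma continuous_jacobiAm (hk : k ^ 2 < 1) : Continuous (jacobiAm k) :=
  (strictMono_jacobiAm hk).monotone.continuous_of_surjective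
    fun θ => ⟨_, jacobiAm_ellipticF hk θ⟩

lemma jacobiAm_neg (hk : k ^ 2 < 1) (y : ℝ) : jacobiAm k (-y) = -jacobiAm k y := by
  apply (strictMono_ellipticF hk).injective
  rw [ellipticF_neg, ellipticF_jacobiAm hk, ellipticF_jacobiAm hk]

lemma jacobiAm_add_two_mul_ellipticK (hk : k ^ 2 < 1) (y : ℝ) :
    jacobiAm k (y + 2 * ellipticK k) = jacobiAm k y + π := by
  apply (strictMono_ellipticF hk).injective
  rw [ellipticF_add_pi hk, ellipticF_jacobiAm hk, ellipticF_jacobiAm hk]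

/-- The Jacobi elliptic sine `sn(y; k) = sin (am(y; k))`. -/
noncomputable def jacobiSn (k y : ℝ) : ℝ := sin (jacobiAm k y)

/-- The Jacobi delta amplitude `dn(y; k) = √(1 - k² sn²(y; k))`, the derivative of `am(·; k)`. -/
noncomputable def jacobiDn (k y : ℝ) : ℝ := √(1 - k ^ 2 * jacobiSn k y ^ 2)

lemma jacobiSn_sq (k y : ℝ) : jacobiSn k y ^ 2 = 1 - jacobiCn k y ^ 2 := sin_sq _

lemma jacobiDn_pos (hk : k ^ 2 < 1) (y : ℝ) : 0 < jacobiDn k y :=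
  sqrt_pos.2 (one_sub_sq_mul_sin_sq_pos hk _)

lemma jacobiDn_sq (hk : k ^ 2 < 1) (y : ℝ) :
    jacobiDn k y ^ 2 = 1 - k ^ 2 * jacobiSn k y ^ 2 :=
  sq_sqrt (one_sub_sq_mul_sin_sq_pos hk _).le

lemma hasDerivAt_jacobiAm (hk : k ^ 2 < 1) (y : ℝ) :
    HasDerivAt (jacobiAm k) (jacobiDn k y) y := by
  have hF : HasDerivAt (ellipticF k) (1 / jacobiDn k y) (jacobiAm k y) :=
    hasDerivAt_ellipticF hk _
  simpa using HasDerivAt.of_local_left_inverse (continuous_jacobiAm hk).continuousAt hF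
    (one_div_pos.2 (jacobiDn_pos hk y)).ne' (Eventually.of_forall (ellipticF_jacobiAm hk))

lemma hasDerivAt_jacobiCn (hk : k ^ 2 < 1) (y : ℝ) :
    HasDerivAt (jacobiCn k) (-(jacobiSn k y * jacobiDn k y)) y := by
  rw [← neg_mul]
  exact (hasDerivAt_jacobiAm hk y).cos

lemma hasDerivAt_jacobiSn (hk : k ^ 2 < 1) (y : ℝ) :
    HasDerivAt (jacobiSn k) (jacobiCn k y * jacobiDn k y) y :=
  (hasDerivAt_jacobiAm hk y).sin

lemma hasDerivAt_jacobiDn (hk : k ^ 2 < 1) (y : ℝ) :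
    HasDerivAt (jacobiDn k) (-(k ^ 2 * jacobiSn k y * jacobiCn k y)) y := by
  have hd : HasDerivAt (jacobiDn k) _ y :=
    ((((hasDerivAt_jacobiSn hk y).pow 2).const_mul (k ^ 2)).const_sub 1).sqrt
      (one_sub_sq_mul_sin_sq_pos hk _).ne'
  refine hd.congr_deriv ?_
  have hne := (jacobiDn_pos hk y).ne'
  change -(k ^ 2 * (2 * jacobiSn k y ^ 1 * (jacobiCn k y * jacobiDn k y))) / (2 * jacobiDn k y) = _
  field_simp

lemma hasDerivAt_deriv_jacobiCn (hk : k ^ 2 < 1) (y : ℝ) :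
    HasDerivAt (fun z => -(jacobiSn k z * jacobiDn k z))
      ((2 * k ^ 2 - 1) * jacobiCn k y - 2 * k ^ 2 * jacobiCn k y ^ 3) y := by
  refine ((hasDerivAt_jacobiSn hk y).mul (hasDerivAt_jacobiDn hk y)).neg.congr_deriv ?_
  linear_combination -jacobiCn k y * jacobiDn_sq hk y +
    2 * k ^ 2 * jacobiCn k y * jacobiSn_sq k y

lemma jacobiCn_neg (hk : k ^ 2 < 1) (y : ℝ) : jacobiCn k (-y) = jacobiCn k y := by
  rw [jacobiCn, jacobiAm_neg hk, cos_neg, jacobiCn]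

lemma jacobiCn_abs (hk : k ^ 2 < 1) (y : ℝ) : jacobiCn k |y| = jacobiCn k y := by
  rcases abs_choice y with h | h <;> rw [h]
  exact jacobiCn_neg hk y

lemma antiperiodic_jacobiCn (hk : k ^ 2 < 1) :
    Function.Antiperiodic (jacobiCn k) (2 * ellipticK k) := fun y => by
  rw [jacobiCn, jacobiAm_add_two_mul_ellipticK hk, cos_add_pi, jacobiCn]

end EllipticFunctions

section CompleteEllipticIntegral

open Real

variable {k : ℝ}

lemma ellipticK_pos (hk : k ^ 2 < 1) : 0 < ellipticK k :=
  (div_pos pi_pos two_pos).trans_le (le_ellipticF hk (by positivity))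

lemma strictMonoOn_ellipticK : StrictMonoOn ellipticK (Ico 0 1) := by
  intro k hk l hl hkl
  have hk₁ : k ^ 2 < 1 := (sq_lt_one_iff₀ hk.1).2 hk.2
  have hl₁ : l ^ 2 < 1 := (sq_lt_one_iff₀ hl.1).2 hl.2
  have hsq : k ^ 2 < l ^ 2 := pow_lt_pow_left₀ hkl hk.1 two_ne_zero
  refine intervalIntegral.integral_lt_integral_of_continuousOn_of_le_of_exists_lt
    (by positivity) (continuous_ellipticF_integrand hk₁).continuousOn
    (continuous_ellipticF_integrand hl₁).continuousOn (fun s _ => ?_)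
    ⟨π / 2, ⟨by positivity, le_rfl⟩, ?_⟩
  · have := sqrt_pos.2 (one_sub_sq_mul_sin_sq_pos hl₁ s)
    gcongr
  · have := sqrt_pos.2 (sub_pos.2 hl₁)
    have := sub_pos.2 hl₁
    simp only [sin_pi_div_two, one_pow, mul_one]
    gcongr

lemma continuousOn_ellipticF :
    ContinuousOn (fun p : ℝ × ℝ => ellipticF p.1 p.2) (Ioo (-1) 1 ×ˢ univ) := by
  rintro ⟨k, θ⟩ ⟨hk, -⟩
  obtain ⟨c, hc, hc₁⟩ := exists_between (abs_lt.2 hk)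
  have hc_sq : 0 < 1 - c ^ 2 := sub_pos.2 ((sq_lt_one_iff₀ ((abs_nonneg k).trans hc.le)).2 hc₁)
  -- Truncating the radicand below makes the integrand continuous for all moduli.
  have hcont : Continuous fun p : ℝ × ℝ => ∫ s in (0 : ℝ)..p.2,
      1 / √(max (1 - p.1 ^ 2 * sin s ^ 2) (1 - c ^ 2)) := by
    refine intervalIntegral.continuous_parametric_intervalIntegral_of_continuous ?_ continuous_snd
    refine Continuous.div (by fun_prop) (by fun_prop) fun s => ?_
    exact (sqrt_pos.2 (hc_sq.trans_le (le_max_right _ _))).ne'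
  refine (hcont.continuousAt.congr ?_).continuousWithinAt
  have hnear : ∀ᶠ p : ℝ × ℝ in 𝓝 (k, θ), |p.1| < c :=
    (continuous_fst.abs.tendsto (k, θ)).eventually (gt_mem_nhds hc)
  filter_upwards [hnear] with p hp
  have hp_sq : p.1 ^ 2 ≤ c ^ 2 := sq_le_sq.2 (hp.le.trans (le_abs_self c))
  refine intervalIntegral.integral_congr fun s _ => ?_
  rw [max_eq_left]
  linarith [mul_le_of_le_one_right (sq_nonneg p.1) (sin_sq_le_one s)]

lemma continuousOn_ellipticK : ContinuousOn ellipticK (Ioo (-1) 1) :=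
  continuousOn_ellipticF.comp (f := fun k => (k, π / 2)) (by fun_prop) fun _ hk => ⟨hk, trivial⟩

lemma sqrt_one_sub_sq_mul_sin_sq_le {s : ℝ} (hk : k ^ 2 ≤ 1) (hs : s ∈ Icc 0 (π / 2)) :
    √(1 - k ^ 2 * sin s ^ 2) ≤ π / 2 + √(1 - k ^ 2) - s := by
  have hs₂ : 0 ≤ π / 2 - s := sub_nonneg.2 hs.2
  have hq := sqrt_nonneg (1 - k ^ 2)
  have hcos : cos s ^ 2 ≤ (π / 2 - s) ^ 2 := by
    rw [← sin_pi_div_two_sub]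
    exact pow_le_pow_left₀ (sin_nonneg_of_nonneg_of_le_pi hs₂ (by linarith [hs.1, pi_pos]))
      (sin_le hs₂) 2
  rw [sqrt_le_left (by linarith)]
  calc 1 - k ^ 2 * sin s ^ 2 = cos s ^ 2 + (1 - k ^ 2) * sin s ^ 2 := by rw [cos_sq']; ring
    _ ≤ (π / 2 - s) ^ 2 + (1 - k ^ 2) :=
        add_le_add hcos (mul_le_of_le_one_right (sub_nonneg.2 hk) (sin_sq_le_one s))
    _ = (π / 2 - s) ^ 2 + √(1 - k ^ 2) ^ 2 := by rw [sq_sqrt (sub_nonneg.2 hk)]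
    _ ≤ (π / 2 - s + √(1 - k ^ 2)) ^ 2 := by nlinarith [mul_nonneg hs₂ hq]
    _ = (π / 2 + √(1 - k ^ 2) - s) ^ 2 := by ring

lemma log_le_ellipticK (hk : k ^ 2 < 1) :
    log ((π / 2 + √(1 - k ^ 2)) / √(1 - k ^ 2)) ≤ ellipticK k := by
  have hq : 0 < √(1 - k ^ 2) := sqrt_pos.2 (sub_pos.2 hk)
  have hpi : 0 < π / 2 := by positivity
  have hint : ∫ s in (0 : ℝ)..(π / 2), 1 / (π / 2 + √(1 - k ^ 2) - s) =
      log ((π / 2 + √(1 - k ^ 2)) / √(1 - k ^ 2)) := by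
    rw [intervalIntegral.integral_comp_sub_left (fun t => 1 / t),
      integral_one_div_of_pos (by linarith) (by linarith), sub_zero, add_sub_cancel_left]
  rw [← hint]
  refine intervalIntegral.integral_mono_on hpi.le (ContinuousOn.intervalIntegrable fun s hs => ?_)
    (intervalIntegrable_ellipticF_integrand hk _ _) fun s hs => ?_
  · rw [uIcc_of_le hpi.le] at hs
    exact ContinuousAt.continuousWithinAt
      (ContinuousAt.div (by fun_prop) (by fun_prop) (by linarith [hs.2]))
  · exact one_div_le_one_div_of_le (sqrt_pos.2 (one_sub_sq_mul_sin_sq_pos hk s))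
      (sqrt_one_sub_sq_mul_sin_sq_le hk.le hs)

lemma tendsto_ellipticK_atTop : Tendsto ellipticK (𝓝[<] 1) atTop := by
  have hmem : ∀ᶠ k : ℝ in 𝓝[<] 1, k ^ 2 < 1 := by
    filter_upwards [Ioo_mem_nhdsLT (one_pos (α := ℝ))] with k hk
    exact (sq_lt_one_iff₀ hk.1.le).2 hk.2
  have hsqrt : Tendsto (fun k : ℝ => √(1 - k ^ 2)) (𝓝[<] 1) (𝓝[>] 0) := by
    refine tendsto_nhdsWithin_iff.2
      ⟨?_, hmem.mono fun k hk => mem_Ioi.2 (sqrt_pos.2 (sub_pos.2 hk))⟩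
    have hcont : Continuous fun k : ℝ => √(1 - k ^ 2) := by fun_prop
    simpa using (hcont.tendsto 1).mono_left nhdsWithin_le_nhds
  have hdiv : Tendsto (fun k : ℝ => (π / 2 + √(1 - k ^ 2)) / √(1 - k ^ 2)) (𝓝[<] 1) atTop := by
    have hinv : Tendsto (fun k : ℝ => π / 2 * (√(1 - k ^ 2))⁻¹) (𝓝[<] 1) atTop :=
      (tendsto_inv_nhdsGT_zero.comp hsqrt).const_mul_atTop (by positivity)
    refine tendsto_atTop_mono (fun k => ?_) hinv
    rw [← div_eq_mul_inv]
    gcongr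
    exact le_add_of_nonneg_right (sqrt_nonneg _)
  exact tendsto_atTop_mono' _ (hmem.mono fun k => log_le_ellipticK)
    (tendsto_log_atTop.comp hdiv)

lemma one_div_sqrt_two_sq : (1 / √2) ^ 2 = (1 / 2 : ℝ) := by
  rw [div_pow, sq_sqrt zero_le_two, one_pow]

lemma one_div_sqrt_two_lt_one : 1 / √2 < (1 : ℝ) :=
  (div_lt_one (by positivity)).2 (lt_sqrt_of_sq_lt (by norm_num))

lemma mem_Ioo_one_div_sqrt_two_one_iff :
    k ∈ Ioo (1 / √2) 1 ↔ 0 < k ∧ 1 < 2 * k ^ 2 ∧ k ^ 2 < 1 := by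
  have hpos : 0 < 1 / √(2 : ℝ) := by positivity
  have hsq : 0 ≤ k → (1 / √2 < k ↔ 1 < 2 * k ^ 2) := fun hk => by
    rw [← pow_lt_pow_iff_left₀ hpos.le hk two_ne_zero, one_div_sqrt_two_sq, div_lt_iff₀' two_pos]
  constructor
  · rintro ⟨hk, hk₁⟩
    have hk₀ := (hpos.trans hk).le
    exact ⟨hpos.trans hk, (hsq hk₀).1 hk, (sq_lt_one_iff₀ hk₀).2 hk₁⟩
  · rintro ⟨hk₀, hk, hk₁⟩
    exact ⟨(hsq hk₀.le).2 hk, (sq_lt_one_iff₀ hk₀.le).1 hk₁⟩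

lemma eventually_mem_Ioo_one_div_sqrt_two_one : ∀ᶠ k : ℝ in 𝓝[<] 1, k ∈ Ioo (1 / √2) (1 : ℝ) :=
  Ioo_mem_nhdsLT one_div_sqrt_two_lt_one

lemma periodS_one_div_sqrt_two : periodS (1 / √2) = 0 := by simp [periodS]

lemma strictMonoOn_periodS : StrictMonoOn periodS (Ico (1 / √2) 1) := by
  intro k hk l hl hkl
  have hpos : 0 < 1 / √(2 : ℝ) := by positivity
  have hk₀ := hpos.trans_le hk.1
  have hl₀ := hpos.trans_le hl.1
  have hK : ellipticK k < ellipticK l :=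
    strictMonoOn_ellipticK ⟨hk₀.le, hk.2⟩ ⟨hl₀.le, hl.2⟩ hkl
  have hK₀ := ellipticK_pos ((sq_lt_one_iff₀ hk₀.le).2 hk.2)
  have hk_half : 1 / 2 ≤ k ^ 2 := by
    rw [← one_div_sqrt_two_sq]
    exact pow_le_pow_left₀ hpos.le hk.1 2
  have hsqrt : √(2 * k ^ 2 - 1) < √(2 * l ^ 2 - 1) :=
    sqrt_lt_sqrt (by linarith) (by gcongr)
  exact mul_lt_mul'' (by gcongr) hK (by positivity) hK₀.le

lemma periodS_pos (hk : k ∈ Ioo (1 / √2) 1) : 0 < periodS k := by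
  rw [← periodS_one_div_sqrt_two]
  exact strictMonoOn_periodS ⟨le_rfl, one_div_sqrt_two_lt_one⟩ (Ioo_subset_Ico_self hk) hk.1

lemma continuousOn_periodS : ContinuousOn periodS (Ioo (-1) 1) :=
  (Continuous.continuousOn (by fun_prop)).mul continuousOn_ellipticK

lemma tendsto_periodS_atTop : Tendsto periodS (𝓝[<] 1) atTop := by
  have hcont : Continuous fun k : ℝ => 4 * √(2 * k ^ 2 - 1) := by fun_prop
  have hlim : Tendsto (fun k : ℝ => 4 * √(2 * k ^ 2 - 1)) (𝓝[<] 1) (𝓝 4) := by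
    convert (hcont.tendsto 1).mono_left nhdsWithin_le_nhds using 2
    norm_num
  exact hlim.pos_mul_atTop four_pos tendsto_ellipticK_atTop

lemma surjOn_periodS : SurjOn periodS (Ioo (1 / √2) 1) (Ioi 0) := by
  intro y hy
  obtain ⟨c, hc, hcy⟩ := (eventually_mem_Ioo_one_div_sqrt_two_one.and
    (tendsto_periodS_atTop.eventually_gt_atTop y)).exists
  have hsub : Icc (1 / √2) c ⊆ Ioo (-1) 1 := fun k hk =>
    ⟨by linarith [hk.1, show 0 < 1 / √(2 : ℝ) by positivity], hk.2.trans_lt hc.2⟩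
  obtain ⟨k, hk, hky⟩ := intermediate_value_Ioo hc.1.le (continuousOn_periodS.mono hsub)
    ⟨periodS_one_div_sqrt_two.trans_lt hy, hcy⟩
  exact ⟨k, ⟨hk.1, hk.2.trans hc.2⟩, hky⟩

end CompleteEllipticIntegral

section Matching

open Real

variable {k l θ : ℝ}

lemma ellipticF_arcsin (hk : k ^ 2 < 1) (hl : l ^ 2 < 1) :
    ellipticF k (arcsin l) =
      ∫ t in (0 : ℝ)..1, l / (√(1 - (l * t) ^ 2) * √(1 - (k * l * t) ^ 2)) := by
  have hlt : ∀ t ∈ uIcc (0 : ℝ) 1, (l * t) ^ 2 < 1 := fun t ht => by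
    rw [uIcc_of_le zero_le_one] at ht
    rw [mul_pow]
    exact (mul_le_of_le_one_right (sq_nonneg l) (pow_le_one₀ ht.1 ht.2)).trans_lt hl
  have hsub := intervalIntegral.integral_comp_mul_deriv (a := 0) (b := 1)
    (f := fun t => arcsin (l * t)) (f' := fun t => 1 / √(1 - (l * t) ^ 2) * l)
    (g := fun s => 1 / √(1 - k ^ 2 * sin s ^ 2))
    (fun t ht => by
      have hmem := abs_lt.1 ((sq_lt_one_iff_abs_lt_one _).1 (hlt t ht))
      simpa [Function.comp_def] using
        (hasDerivAt_arcsin hmem.1.ne' hmem.2.ne).comp t ((hasDerivAt_id t).const_mul l))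
    (fun t ht => by
      refine ContinuousAt.continuousWithinAt (ContinuousAt.mul ?_ continuousAt_const)
      exact ContinuousAt.div (by fun_prop) (by fun_prop) (sqrt_pos.2 (sub_pos.2 (hlt t ht))).ne')
    (continuous_ellipticF_integrand hk)
  simp only [mul_zero, mul_one, arcsin_zero] at hsub
  rw [ellipticF, ← hsub]
  refine intervalIntegral.integral_congr fun t ht => ?_
  have hmem := abs_le.1 ((sq_le_one_iff_abs_le_one _).1 (hlt t ht).le)
  simp only [Function.comp]
  rw [sin_arcsin hmem.1 hmem.2, ← mul_pow, ← mul_assoc]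
  field_simp

lemma ellipticF_arcsin_le_ellipticF_arcsin {k' l' : ℝ} (hk : k ^ 2 < 1) (hk' : k' ^ 2 < 1)
    (hl : 0 ≤ l) (hll' : l ≤ l') (hl' : l' < 1) (hkl : (k * l) ^ 2 ≤ (k' * l') ^ 2) :
    ellipticF k (arcsin l) ≤ ellipticF k' (arcsin l') := by
  have hl'₀ : 0 ≤ l' := hl.trans hll'
  have hl_sq : l ^ 2 < 1 := (sq_lt_one_iff₀ hl).2 (hll'.trans_lt hl')
  have hl'_sq : l' ^ 2 < 1 := (sq_lt_one_iff₀ hl'₀).2 hl'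
  have hpos : ∀ {c : ℝ}, c ^ 2 < 1 → ∀ t ∈ Icc (0 : ℝ) 1, 0 < √(1 - (c * t) ^ 2) :=
    fun {c} hc t ht => by
      rw [sqrt_pos, sub_pos, mul_pow]
      exact (mul_le_of_le_one_right (sq_nonneg c) (pow_le_one₀ ht.1 ht.2)).trans_lt hc
  have hmul : ∀ {c d : ℝ}, c ^ 2 < 1 → d ^ 2 < 1 → (c * d) ^ 2 < 1 := fun hc hd => by
    rw [mul_pow]
    exact mul_lt_one_of_nonneg_of_lt_one_left (sq_nonneg _) hc hd.le
  have hint : ∀ {c d : ℝ}, c ^ 2 < 1 → d ^ 2 < 1 → IntervalIntegrable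
      (fun t => d / (√(1 - (d * t) ^ 2) * √(1 - (c * d * t) ^ 2))) volume 0 1 := fun hc hd => by
    refine ContinuousOn.intervalIntegrable fun t ht => ?_
    rw [uIcc_of_le zero_le_one] at ht
    refine ContinuousAt.continuousWithinAt (ContinuousAt.div (by fun_prop) (by fun_prop) ?_)
    exact (mul_pos (hpos hd t ht) (hpos (hmul hc hd) t ht)).ne'
  rw [ellipticF_arcsin hk hl_sq, ellipticF_arcsin hk' hl'_sq]
  refine intervalIntegral.integral_mono_on zero_le_one (hint hk hl_sq) (hint hk' hl'_sq)
    fun t ht => ?_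
  have := ht.1
  have h₁ := hpos hl'_sq t ht
  have h₂ := hpos (hmul hk' hl'_sq) t ht
  rw [mul_pow (k * l), mul_pow l]
  rw [mul_pow (k' * l'), mul_pow l'] at *
  gcongr

lemma sub_div_le_ellipticF_sub_ellipticF {a b : ℝ} (hk : k ^ 2 < 1) (ha : 0 ≤ a) (hab : a ≤ b)
    (hb : b ≤ π / 2) :
    (b - a) / √(1 - k ^ 2 * sin a ^ 2) ≤ ellipticF k b - ellipticF k a := by
  rw [ellipticF_sub_ellipticF hk]
  have hconst : ∫ _ in a..b, 1 / √(1 - k ^ 2 * sin a ^ 2) ≤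
      ∫ s in a..b, 1 / √(1 - k ^ 2 * sin s ^ 2) := by
    refine intervalIntegral.integral_mono_on hab (by simp)
      (intervalIntegrable_ellipticF_integrand hk _ _) fun s hs => ?_
    have hpos := sqrt_pos.2 (one_sub_sq_mul_sin_sq_pos hk s)
    have hsin_nonneg : 0 ≤ sin a := sin_nonneg_of_nonneg_of_le_pi ha (by linarith [pi_pos])
    have hsin : sin a ≤ sin s :=
      sin_le_sin_of_le_of_le_pi_div_two (by linarith [pi_pos]) (hs.2.trans hb) hs.1
    gcongr
  simpa [div_eq_mul_inv] using hconst

/-- The angle `φ ∈ (0, π/2)` with `cos φ = √(2k² - 1) / k`: a cnoidal wave of modulus `k` takes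
the value `√(2|ω|)` exactly where the amplitude `am` equals `±φ` modulo `2π`. It is encoded through
`sin φ = √(1 - k²) / k`. -/
noncomputable def matchAngle (k : ℝ) : ℝ := arcsin (√(1 - k ^ 2) / k)

/-- The distance from a maximum point of `cn(·; k)` to the nearest point with amplitude
`matchAngle k`, as a fraction of the quarter period `K(k)`. -/
noncomputable def matchRatio (k : ℝ) : ℝ := ellipticF k (matchAngle k) / ellipticK k

lemma sqrt_one_sub_sq_div_mem_Ioo (hk : k ∈ Ioo (1 / √2) 1) : √(1 - k ^ 2) / k ∈ Ioo 0 1 := by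
  obtain ⟨hk₀, hk₂, hk₁⟩ := mem_Ioo_one_div_sqrt_two_one_iff.1 hk
  refine ⟨div_pos (sqrt_pos.2 (sub_pos.2 hk₁)) hk₀, ?_⟩
  rw [div_lt_one hk₀, sqrt_lt' hk₀]
  linarith

lemma matchAngle_mem_Ioo (hk : k ∈ Ioo (1 / √2) 1) : matchAngle k ∈ Ioo 0 (π / 2) :=
  ⟨arcsin_pos.2 (sqrt_one_sub_sq_div_mem_Ioo hk).1,
    arcsin_lt_pi_div_two.2 (sqrt_one_sub_sq_div_mem_Ioo hk).2⟩

lemma sin_matchAngle (hk : k ∈ Ioo (1 / √2) 1) : sin (matchAngle k) = √(1 - k ^ 2) / k := by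
  obtain ⟨hpos, hlt⟩ := sqrt_one_sub_sq_div_mem_Ioo hk
  exact sin_arcsin (by linarith) hlt.le

lemma cos_matchAngle (hk : k ∈ Ioo (1 / √2) 1) : cos (matchAngle k) = √(2 * k ^ 2 - 1) / k := by
  obtain ⟨hk₀, hk₂, hk₁⟩ := mem_Ioo_one_div_sqrt_two_one_iff.1 hk
  rw [matchAngle, cos_arcsin, div_pow, sq_sqrt (sub_nonneg.2 hk₁.le), one_sub_div (by positivity),
    sqrt_div (by linarith), sqrt_sq hk₀.le]
  ring_nf

lemma antitoneOn_ellipticF_matchAngle :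
    AntitoneOn (fun k => ellipticF k (matchAngle k)) (Ioo (1 / √2) 1) := by
  intro k hk l hl hkl
  obtain ⟨hk₀, -, hk₁⟩ := mem_Ioo_one_div_sqrt_two_one_iff.1 hk
  obtain ⟨hl₀, -, hl₁⟩ := mem_Ioo_one_div_sqrt_two_one_iff.1 hl
  have hsqrt : √(1 - l ^ 2) ≤ √(1 - k ^ 2) := by gcongr
  refine ellipticF_arcsin_le_ellipticF_arcsin hl₁ hk₁ (sqrt_one_sub_sq_div_mem_Ioo hl).1.le
    (by gcongr) (sqrt_one_sub_sq_div_mem_Ioo hk).2 ?_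
  rw [mul_div_cancel₀ _ hl₀.ne', mul_div_cancel₀ _ hk₀.ne']
  gcongr

lemma matchRatio_pos (hk : k ∈ Ioo (1 / √2) 1) : 0 < matchRatio k := by
  obtain ⟨-, -, hk₁⟩ := mem_Ioo_one_div_sqrt_two_one_iff.1 hk
  have hφ := (matchAngle_mem_Ioo hk).1
  exact div_pos (hφ.trans_le (le_ellipticF hk₁ hφ.le)) (ellipticK_pos hk₁)

lemma matchRatio_lt_one (hk : k ∈ Ioo (1 / √2) 1) : matchRatio k < 1 := by
  obtain ⟨-, -, hk₁⟩ := mem_Ioo_one_div_sqrt_two_one_iff.1 hk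
  rw [matchRatio, div_lt_one (ellipticK_pos hk₁)]
  exact strictMono_ellipticF hk₁ (matchAngle_mem_Ioo hk).2

lemma matchRatio_one_div_sqrt_two : matchRatio (1 / √2) = 1 := by
  have hsqrt : √(1 - (1 / √2) ^ 2) = 1 / √(2 : ℝ) := by
    rw [one_div_sqrt_two_sq, sub_half, sqrt_div zero_le_one, sqrt_one]
  have hangle : matchAngle (1 / √2) = π / 2 := by
    rw [matchAngle, hsqrt, div_self (by positivity), arcsin_one]
  rw [matchRatio, hangle]
  exact div_self (ellipticK_pos (one_div_sqrt_two_sq.trans_lt one_half_lt_one)).ne'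

lemma strictAntiOn_matchRatio : StrictAntiOn matchRatio (Ioo (1 / √2) 1) := by
  intro k hk l hl hkl
  obtain ⟨hk₀, -, hk₁⟩ := mem_Ioo_one_div_sqrt_two_one_iff.1 hk
  obtain ⟨hl₀, -, -⟩ := mem_Ioo_one_div_sqrt_two_one_iff.1 hl
  have hK : ellipticK k < ellipticK l :=
    strictMonoOn_ellipticK ⟨hk₀.le, hk.2⟩ ⟨hl₀.le, hl.2⟩ hkl
  have hφ := (matchAngle_mem_Ioo hk).1
  exact div_lt_div₀' (antitoneOn_ellipticF_matchAngle hk hl hkl.le) hK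
    (hφ.trans_le (le_ellipticF hk₁ hφ.le)) (ellipticK_pos hk₁)

lemma continuousOn_matchRatio : ContinuousOn matchRatio (Ioo 0 1) := by
  have hsub : Ioo (0 : ℝ) 1 ⊆ Ioo (-1) 1 := Ioo_subset_Ioo_left neg_one_lt_zero.le
  have hangle : ContinuousOn matchAngle (Ioo 0 1) := by
    refine continuous_arcsin.comp_continuousOn (ContinuousOn.div ?_ continuousOn_id ?_)
    · fun_prop
    · exact fun k hk => hk.1.ne'
  have hF : ContinuousOn (fun k => ellipticF k (matchAngle k)) (Ioo 0 1) :=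
    continuousOn_ellipticF.comp (f := fun k => (k, matchAngle k)) (continuousOn_id.prodMk hangle)
      fun k hk => ⟨hsub hk, trivial⟩
  exact hF.div (continuousOn_ellipticK.mono hsub) fun k hk =>
    (ellipticK_pos ((sq_lt_one_iff₀ hk.1.le).2 hk.2)).ne'

lemma tendsto_matchRatio_zero : Tendsto matchRatio (𝓝[<] 1) (𝓝 0) := by
  obtain ⟨c, hc⟩ := exists_between one_div_sqrt_two_lt_one
  have hlim : Tendsto (fun k => ellipticF c (matchAngle c) / ellipticK k) (𝓝[<] 1) (𝓝 0) :=
    tendsto_ellipticK_atTop.const_div_atTop _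
  refine tendsto_of_tendsto_of_tendsto_of_le_of_le' tendsto_const_nhds hlim ?_ ?_
  · filter_upwards [eventually_mem_Ioo_one_div_sqrt_two_one] with k hk
    exact (matchRatio_pos hk).le
  · filter_upwards [eventually_mem_Ioo_one_div_sqrt_two_one, Ioo_mem_nhdsLT hc.2] with k hk hck
    have := ellipticK_pos (mem_Ioo_one_div_sqrt_two_one_iff.1 hk).2.2
    exact div_le_div_of_nonneg_right (antitoneOn_ellipticF_matchAngle hc hk hck.1.le) this.le

lemma surjOn_matchRatio : SurjOn matchRatio (Ioo (1 / √2) 1) (Ioo 0 1) := by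
  intro θ hθ
  obtain ⟨c, hc, hcθ⟩ := (eventually_mem_Ioo_one_div_sqrt_two_one.and
    (tendsto_matchRatio_zero.eventually (gt_mem_nhds hθ.1))).exists
  have hsub : Icc (1 / √2) c ⊆ Ioo 0 1 := fun k hk =>
    ⟨(show 0 < 1 / √(2 : ℝ) by positivity).trans_le hk.1, hk.2.trans_lt hc.2⟩
  obtain ⟨k, hk, hkθ⟩ := intermediate_value_Ioo' hc.1.le (continuousOn_matchRatio.mono hsub)
    ⟨hcθ, hθ.2.trans_eq matchRatio_one_div_sqrt_two.symm⟩
  exact ⟨k, ⟨hk.1, hk.2.trans hc.2⟩, hkθ⟩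

/-- The inverse of the decreasing bijection `matchRatio : (1/√2, 1) → (0, 1)`. -/
noncomputable def matchModulus (θ : ℝ) : ℝ := Function.invFunOn matchRatio (Ioo (1 / √2) 1) θ

lemma matchModulus_mem_Ioo (hθ : θ ∈ Ioo 0 1) : matchModulus θ ∈ Ioo (1 / √2) 1 :=
  Function.invFunOn_mem (surjOn_matchRatio hθ)

lemma matchRatio_matchModulus (hθ : θ ∈ Ioo 0 1) : matchRatio (matchModulus θ) = θ :=
  Function.invFunOn_eq (surjOn_matchRatio hθ)

lemma matchRatio_eq_iff (hk : k ∈ Ioo (1 / √2) 1) (hθ : θ ∈ Ioo 0 1) :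
    matchRatio k = θ ↔ k = matchModulus θ := by
  rw [← strictAntiOn_matchRatio.injOn.eq_iff hk (matchModulus_mem_Ioo hθ),
    matchRatio_matchModulus hθ]

lemma strictAntiOn_matchModulus : StrictAntiOn matchModulus (Ioo 0 1) := by
  intro θ hθ η hη h
  rwa [← strictAntiOn_matchRatio.lt_iff_gt (matchModulus_mem_Ioo hθ) (matchModulus_mem_Ioo hη),
    matchRatio_matchModulus hθ, matchRatio_matchModulus hη]

lemma tendsto_matchModulus : Tendsto matchModulus (𝓝[<] 1) (𝓝[>] (1 / √2)) := by
  have hev : ∀ᶠ θ : ℝ in 𝓝[<] 1, θ ∈ Ioo (0 : ℝ) 1 := Ioo_mem_nhdsLT one_pos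
  have hgt : ∀ᶠ θ : ℝ in 𝓝[<] 1, 1 / √2 < matchModulus θ :=
    hev.mono fun θ hθ => (matchModulus_mem_Ioo hθ).1
  refine tendsto_nhdsWithin_iff.2
    ⟨tendsto_order.2 ⟨fun c hc => hgt.mono fun θ => hc.trans, fun c hc => ?_⟩, hgt⟩
  obtain ⟨k, hk⟩ := exists_between (lt_min hc one_div_sqrt_two_lt_one)
  have hk_mem : k ∈ Ioo (1 / √2) (1 : ℝ) := ⟨hk.1, hk.2.trans_le (min_le_right _ _)⟩
  filter_upwards [hev, Ioo_mem_nhdsLT (matchRatio_lt_one hk_mem)] with θ hθ hkθ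
  refine lt_trans ?_ (hk.2.trans_le (min_le_left _ _))
  rw [← strictAntiOn_matchRatio.lt_iff_gt hk_mem (matchModulus_mem_Ioo hθ),
    matchRatio_matchModulus hθ]
  exact hkθ.1

lemma periodS_le (hk : k ∈ Ioo (1 / √2) 1) :
    periodS k ≤ 4 * k ^ 2 * ellipticK k ^ 2 * (1 - matchRatio k) := by
  obtain ⟨hk₀, -, hk₁⟩ := mem_Ioo_one_div_sqrt_two_one_iff.1 hk
  obtain ⟨hφ₀, hφ₁⟩ := matchAngle_mem_Ioo hk
  have hK := ellipticK_pos hk₁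
  have hcos : √(2 * k ^ 2 - 1) / k ≤ π / 2 - matchAngle k := by
    rw [← cos_matchAngle hk, ← sin_pi_div_two_sub]
    exact sin_le (sub_nonneg.2 hφ₁.le)
  have hF : (π / 2 - matchAngle k) / k ≤ ellipticK k - ellipticF k (matchAngle k) := by
    refine le_of_eq_of_le ?_ (sub_div_le_ellipticF_sub_ellipticF hk₁ hφ₀.le hφ₁.le le_rfl)
    rw [sin_matchAngle hk, div_pow, sq_sqrt (sub_nonneg.2 hk₁.le),
      mul_div_cancel₀ _ (by positivity), sub_sub_cancel, sqrt_sq hk₀.le]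
  calc periodS k = 4 * k ^ 2 * ellipticK k * (√(2 * k ^ 2 - 1) / k / k) := by
        rw [periodS]
        field_simp
    _ ≤ 4 * k ^ 2 * ellipticK k * (ellipticK k - ellipticF k (matchAngle k)) := by
        gcongr
        exact (div_le_div_of_nonneg_right hcos hk₀.le).trans hF
    _ = 4 * k ^ 2 * ellipticK k ^ 2 * (1 - matchRatio k) := by
        rw [matchRatio]
        field_simp

lemma jacobiCn_mul_ellipticK_eq_iff (hk : k ∈ Ioo (1 / √2) 1) (hθ : θ ∈ Ioo 0 1) :
    jacobiCn k (θ * ellipticK k) = √(2 * k ^ 2 - 1) / k ↔ matchRatio k = θ := by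
  obtain ⟨-, -, hk₁⟩ := mem_Ioo_one_div_sqrt_two_one_iff.1 hk
  have hK := ellipticK_pos hk₁
  have hφ := matchAngle_mem_Ioo hk
  have hφ_mem : matchAngle k ∈ Icc 0 π := ⟨hφ.1.le, hφ.2.le.trans (half_le_self pi_nonneg)⟩
  have ham_mem : jacobiAm k (θ * ellipticK k) ∈ Icc 0 π := by
    constructor <;> rw [← (strictMono_ellipticF hk₁).le_iff_le, ellipticF_jacobiAm hk₁]
    · rw [ellipticF_zero]
      exact mul_nonneg hθ.1.le hK.le
    · exact (mul_le_of_le_one_left hK.le hθ.2.le).trans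
        ((strictMono_ellipticF hk₁).monotone (half_le_self pi_nonneg))
  rw [← cos_matchAngle hk, jacobiCn, injOn_cos.eq_iff ham_mem hφ_mem,
    ← (strictMono_ellipticF hk₁).injective.eq_iff, ellipticF_jacobiAm hk₁, matchRatio,
    div_eq_iff hK.ne', eq_comm]

end Matching

lemma isH2_of_hasDerivAt {u v w : ℝ → ℝ} (L : ℝ) (hu : ∀ x, HasDerivAt u (v x) x)
    (hv : ∀ x, HasDerivAt v (w x) x) (hw : Continuous w) : IsH2 L u v w := by
  have hvc : Continuous v := continuous_iff_continuousAt.2 fun x => (hv x).continuousAt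
  refine ⟨?_, fun x _ => ?_, fun x _ => ?_⟩
  · obtain ⟨C, hC⟩ := (isCompact_Icc (a := 0) (b := L)).exists_bound_of_continuousOn hw.continuousOn
    refine MemLp.of_bound hw.aestronglyMeasurable C ?_
    exact (ae_restrict_iff' measurableSet_Icc).2 (Eventually.of_forall hC)
  · rw [intervalIntegral.integral_eq_sub_of_hasDerivAt (fun t _ => hv t)
      (hw.intervalIntegrable _ _), add_sub_cancel]
  · rw [intervalIntegral.integral_eq_sub_of_hasDerivAt (fun t _ => hu t)
      (hvc.intervalIntegrable _ _), add_sub_cancel]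

section Cnoidal

open Real

variable {L ω θ : ℝ}

lemma modulus_mem_Ioo (hL : 0 < L) (hω : ω < 0) (n : ℕ+) :
    modulus L n ω ∈ Ioo (1 / √2) 1 := by
  have := sqrt_pos.2 (abs_pos.2 hω.ne)
  exact Function.invFunOn_mem (surjOn_periodS (mem_Ioi.2 (by positivity)))

lemma periodS_modulus (hL : 0 < L) (hω : ω < 0) (n : ℕ+) :
    periodS (modulus L n ω) = L * √|ω| / n := by
  have := sqrt_pos.2 (abs_pos.2 hω.ne)
  exact Function.invFunOn_eq (surjOn_periodS (mem_Ioi.2 (by positivity)))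

lemma waveNumber_mul_div (hL : 0 < L) (hω : ω < 0) (n : ℕ+) :
    √(|ω| / (2 * modulus L n ω ^ 2 - 1)) * (L / n) = 4 * ellipticK (modulus L n ω) := by
  obtain ⟨-, hk, -⟩ := mem_Ioo_one_div_sqrt_two_one_iff.1 (modulus_mem_Ioo hL hω n)
  have hS := periodS_modulus hL hω n
  rw [periodS] at hS
  rw [sqrt_div (abs_nonneg _), div_mul_eq_mul_div,
    div_eq_iff (sqrt_pos.2 (sub_pos.2 hk)).ne']
  linear_combination -hS

lemma antiperiodic_cnoidal (hL : 0 < L) (hω : ω < 0) (n : ℕ+) (s : ℝ) :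
    Function.Antiperiodic (cnoidal L n ω s) (L / (2 * n)) := fun x => by
  have hk := (mem_Ioo_one_div_sqrt_two_one_iff.1 (modulus_mem_Ioo hL hω n)).2.2
  have hwave : √(|ω| / (2 * modulus L n ω ^ 2 - 1)) * (x + L / (2 * n) - s) =
      √(|ω| / (2 * modulus L n ω ^ 2 - 1)) * (x - s) + 2 * ellipticK (modulus L n ω) := by
    linear_combination waveNumber_mul_div hL hω n / 2
  rw [cnoidal, cnoidal, hwave, antiperiodic_jacobiCn hk, mul_neg]

lemma periodic_cnoidal (hL : 0 < L) (hω : ω < 0) (n : ℕ+) (s : ℝ) :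
    Function.Periodic (cnoidal L n ω s) (L / n) := by
  have hper : 2 * (L / (2 * n)) = L / n := by field_simp
  exact hper ▸ (antiperiodic_cnoidal hL hω n s).periodic_two_mul

lemma cnoidal_two_mul_sub (hL : 0 < L) (hω : ω < 0) (n : ℕ+) (s x : ℝ) :
    cnoidal L n ω s (2 * s - x) = cnoidal L n ω s x := by
  have hk := (mem_Ioo_one_div_sqrt_two_one_iff.1 (modulus_mem_Ioo hL hω n)).2.2
  rw [cnoidal, cnoidal, show 2 * s - x - s = -(x - s) by ring, mul_neg, jacobiCn_neg hk]

lemma exists_hasDerivAt_cnoidal (hL : 0 < L) (hω : ω < 0) (n : ℕ+) (s : ℝ) :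
    ∃ v : ℝ → ℝ, (∀ x, HasDerivAt (cnoidal L n ω s) (v x) x) ∧
      ∀ x, HasDerivAt v (-(ω * cnoidal L n ω s x) - cnoidal L n ω s x ^ 3) x := by
  have hcn : cnoidal L n ω s = fun x =>
    √(2 * |ω| * modulus L n ω ^ 2 / (2 * modulus L n ω ^ 2 - 1)) *
      jacobiCn (modulus L n ω) (√(|ω| / (2 * modulus L n ω ^ 2 - 1)) * (x - s)) := rfl
  obtain ⟨-, hk₂, hk₁⟩ := mem_Ioo_one_div_sqrt_two_one_iff.1 (modulus_mem_Ioo hL hω n)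
  rw [hcn]
  set k := modulus L n ω
  set A := √(2 * |ω| * k ^ 2 / (2 * k ^ 2 - 1)) with hA
  set B := √(|ω| / (2 * k ^ 2 - 1)) with hB
  have hpos : 0 < 2 * k ^ 2 - 1 := sub_pos.2 hk₂
  have hA_sq : A ^ 2 = 2 * k ^ 2 * B ^ 2 := by
    rw [hA, hB, sq_sqrt (by positivity), sq_sqrt (by positivity)]
    ring
  have hB_sq : B ^ 2 * (2 * k ^ 2 - 1) = -ω := by
    rw [hB, sq_sqrt (by positivity), div_mul_cancel₀ _ hpos.ne', abs_of_neg hω]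
  have hlin : ∀ x, HasDerivAt (fun x => B * (x - s)) B x := fun x => by
    simpa using ((hasDerivAt_id x).sub_const s).const_mul B
  refine ⟨_, fun x => ((hasDerivAt_jacobiCn hk₁ _).comp x (hlin x)).const_mul A, fun x =>
    ((((hasDerivAt_deriv_jacobiCn hk₁ _).comp x (hlin x)).mul_const B).const_mul A).congr_deriv ?_⟩
  linear_combination (A * jacobiCn k (B * (x - s)) ^ 3) * hA_sq +
    A * jacobiCn k (B * (x - s)) * hB_sq

lemma exists_isH2_cnoidal (hL : 0 < L) (hω : ω < 0) (n : ℕ+) (s : ℝ) :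
    ∃ v w : ℝ → ℝ, IsH2 L (cnoidal L n ω s) v w ∧ cnoidal L n ω s 0 = cnoidal L n ω s L ∧
      v 0 = v L ∧ ∀ x, -w x - cnoidal L n ω s x ^ 3 = ω * cnoidal L n ω s x := by
  obtain ⟨v, hu, hv⟩ := exists_hasDerivAt_cnoidal hL hω n s
  have hcont : Continuous (cnoidal L n ω s) :=
    continuous_iff_continuousAt.2 fun x => (hu x).continuousAt
  have hper : Function.Periodic (cnoidal L n ω s) L := by
    have hper := (periodic_cnoidal hL hω n s).nat_mul n
    rwa [mul_div_cancel₀ L (Nat.cast_ne_zero.2 n.ne_zero)] at hper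
  have hv_per : v L = v 0 := by
    have hshift : HasDerivAt (fun x => cnoidal L n ω s (x + L)) (v (0 + L)) 0 :=
      (hu (0 + L)).comp_add_const 0 L
    rw [funext hper, zero_add] at hshift
    exact hshift.unique (hu 0)
  refine ⟨v, _, isH2_of_hasDerivAt L hu hv (by fun_prop), hper.eq.symm, hv_per.symm, fun x => ?_⟩
  ring

lemma cnoidal_zero_eq_sqrt_iff (hL : 0 < L) (hω : ω < 0) (hθ : θ ∈ Ioo 0 1) {n : ℕ+} {s : ℝ}
    (hs : 4 * n * |s| = θ * L) :
    cnoidal L n ω s 0 = √(2 * |ω|) ↔ matchRatio (modulus L n ω) = θ := by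
  have hk := modulus_mem_Ioo hL hω n
  obtain ⟨hk₀, hk₂, hk₁⟩ := mem_Ioo_one_div_sqrt_two_one_iff.1 hk
  have hω' : 0 < √(2 * |ω|) := sqrt_pos.2 (mul_pos two_pos (abs_pos.2 hω.ne))
  have hphase : |√(|ω| / (2 * modulus L n ω ^ 2 - 1)) * (0 - s)| =
      θ * ellipticK (modulus L n ω) := by
    have hs' : |s| = θ * (L / n) / 4 := by
      field_simp
      linear_combination hs
    rw [zero_sub, abs_mul, abs_neg, abs_of_nonneg (sqrt_nonneg _), hs']
    linear_combination θ / 4 * waveNumber_mul_div hL hω n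
  rw [← jacobiCn_mul_ellipticK_eq_iff hk hθ, cnoidal, ← jacobiCn_abs hk₁, hphase,
    sqrt_div (by positivity), sqrt_mul (by positivity), sqrt_sq hk₀.le, eq_div_iff hk₀.ne',
    div_mul_eq_mul_div, div_eq_iff (sqrt_pos.2 (sub_pos.2 hk₂)).ne', mul_assoc,
    mul_right_inj' hω'.ne', mul_comm]

/-- The frequency of the cnoidal wave of period `L / n` whose modulus has matching ratio `θ`. -/
noncomputable def frequency (L : ℝ) (n : ℕ+) (θ : ℝ) : ℝ :=
  -(n * periodS (matchModulus θ) / L) ^ 2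

lemma frequency_neg (hL : 0 < L) (n : ℕ+) (hθ : θ ∈ Ioo 0 1) : frequency L n θ < 0 := by
  have := periodS_pos (matchModulus_mem_Ioo hθ)
  rw [frequency, neg_lt_zero]
  positivity

lemma matchRatio_modulus_eq_iff (hL : 0 < L) (hω : ω < 0) (n : ℕ+) (hθ : θ ∈ Ioo 0 1) :
    matchRatio (modulus L n ω) = θ ↔ ω = frequency L n θ := by
  have hk := modulus_mem_Ioo hL hω n
  have hmatch := matchModulus_mem_Ioo hθ
  have hS := periodS_pos hmatch
  have hroot : L * √|ω| / n = periodS (matchModulus θ) ↔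
      √|ω| = n * periodS (matchModulus θ) / L := by
    rw [div_eq_iff (by positivity), eq_div_iff hL.ne', mul_comm L, mul_comm (n : ℝ)]
  rw [matchRatio_eq_iff hk hθ,
    ← (strictMonoOn_periodS.mono Ioo_subset_Ico_self).injOn.eq_iff hk hmatch,
    periodS_modulus hL hω, hroot, sqrt_eq_iff_eq_sq (abs_nonneg _) (by positivity),
    abs_of_neg hω, neg_eq_iff_eq_neg, frequency]

lemma solvesP_cnoidal_iff {σ L₁ : ℝ} (hL : 0 < L) (hθ : θ ∈ Ioo 0 1) {n : ℕ+} {s : ℝ}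
    (hs : 4 * n * |s| = θ * L)
    (hsymm : ω < 0 → cnoidal L n ω s 0 = σ * cnoidal L n ω s L₁) :
    SolvesP σ L L₁ ω (cnoidal L n ω s) ↔ ω = frequency L n θ := by
  constructor
  · rintro ⟨hω, -, h₀, h₁⟩
    rw [← matchRatio_modulus_eq_iff hL hω n hθ, ← cnoidal_zero_eq_sqrt_iff hL hω hθ hs, h₀, h₁]
  · intro h
    have hω : ω < 0 := h ▸ frequency_neg hL n hθ
    rw [← matchRatio_modulus_eq_iff hL hω n hθ, ← cnoidal_zero_eq_sqrt_iff hL hω hθ hs] at h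
    obtain ⟨v, w, hH2, hu, hv, hode⟩ := exists_isH2_cnoidal hL hω n s
    exact ⟨hω, ⟨v, w, hH2, hu, hv, Eventually.of_forall hode⟩, hsymm hω, hsymm hω ▸ h⟩

end Cnoidal

section FareyPairs

/-- The fractions `a / b < ξ < c / d` are neighbours in a Farey sequence. -/
structure IsFareyPair (ξ : ℝ) (a b c d : ℤ) : Prop where
  left_den_pos : 0 < b
  right_den_pos : 0 < d
  left_lt : a < b * ξ
  lt_right : d * ξ < c
  det_eq_one : b * c - a * d = 1

namespace IsFareyPair

variable {ξ : ℝ} {a b c d : ℤ}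

lemma reflect (h : IsFareyPair ξ a b c d) : IsFareyPair (-ξ) (-c) d (-a) b where
  left_den_pos := h.right_den_pos
  right_den_pos := h.left_den_pos
  left_lt := by push_cast; linarith [h.lt_right]
  lt_right := by push_cast; linarith [h.left_lt]
  det_eq_one := by linarith [h.det_eq_one]

lemma den_mul_add_den_mul (h : IsFareyPair ξ a b c d) :
    d * (b * ξ - a) + b * (c - d * ξ) = 1 := by
  have hdet : (b * c - a * d : ℝ) = 1 := by exact_mod_cast h.det_eq_one
  linarith

lemma exists_left_refinement (h : IsFareyPair ξ a b c d) (hξ : Irrational ξ)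
    (hlt : c - d * ξ < b * ξ - a) :
    ∃ a' b', IsFareyPair ξ a' b' c d ∧ b + d ≤ b' ∧ b' * ξ - a' < c - d * ξ := by
  have hy : 0 < c - d * ξ := sub_pos.2 h.lt_right
  set m : ℤ := ⌊(b * ξ - a) / (c - d * ξ)⌋
  have hm : 1 ≤ m := Int.le_floor.2 (by rw [Int.cast_one, one_le_div hy]; exact hlt.le)
  have hle : m * (c - d * ξ) ≤ b * ξ - a := (le_div_iff₀ hy).1 (Int.floor_le _)
  have hgt : b * ξ - a < (m + 1) * (c - d * ξ) := (div_lt_iff₀ hy).1 (Int.lt_floor_add_one _)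
  have hb : b + d ≤ b + m * d := by nlinarith [h.right_den_pos]
  have hb' : 0 < b + m * d := (add_pos h.left_den_pos h.right_den_pos).trans_le hb
  have hne : ((b + m * d : ℤ) : ℝ) * ξ ≠ (a + m * c : ℤ) :=
    (hξ.intCast_mul hb'.ne').ne_int _
  refine ⟨a + m * c, b + m * d, ⟨hb', h.right_den_pos, hne.symm.lt_of_le ?_, h.lt_right, ?_⟩,
    hb, ?_⟩
  · push_cast
    linarith
  · linear_combination h.det_eq_one
  · push_cast
    linarith

lemma exists_right_refinement (h : IsFareyPair ξ a b c d) (hξ : Irrational ξ)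
    (hlt : b * ξ - a < c - d * ξ) :
    ∃ c' d', IsFareyPair ξ a b c' d' ∧ b + d ≤ d' ∧ c' - d' * ξ < b * ξ - a := by
  obtain ⟨p, q, hpair, hq, hpq⟩ := h.reflect.exists_left_refinement hξ.neg
    (by push_cast; linarith)
  refine ⟨-p, q, by simpa using hpair.reflect, by linarith, ?_⟩
  push_cast at hpq ⊢
  linarith

end IsFareyPair

lemma isFareyPair_floor {ξ : ℝ} (hξ : Irrational ξ) : IsFareyPair ξ ⌊ξ⌋ 1 (⌊ξ⌋ + 1) 1 where
  left_den_pos := one_pos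
  right_den_pos := one_pos
  left_lt := by simpa using (hξ.ne_int _).symm.lt_of_le (Int.floor_le ξ)
  lt_right := by simp
  det_eq_one := by ring

lemma exists_isFareyPair_sub_lt_sub {ξ : ℝ} (hξ : Irrational ξ) :
    ∃ a b c d, IsFareyPair ξ a b c d ∧ b * ξ - a < c - d * ξ := by
  have h := isFareyPair_floor hξ
  have hne : ((1 : ℤ) : ℝ) * ξ - ⌊ξ⌋ ≠ (⌊ξ⌋ + 1 : ℤ) - (1 : ℤ) * ξ := fun heq =>
    (hξ.intCast_mul two_ne_zero).ne_int (2 * ⌊ξ⌋ + 1) (by push_cast at heq ⊢; linarith)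
  rcases hne.lt_or_gt with hlt | hlt
  · exact ⟨_, _, _, _, h, hlt⟩
  · obtain ⟨a, b, h', -, hlt'⟩ := h.exists_left_refinement hξ hlt
    exact ⟨_, _, _, _, h', hlt'⟩

lemma exists_isFareyPair_ge {ξ : ℝ} (hξ : Irrational ξ) (N : ℕ) :
    ∃ a b c d, IsFareyPair ξ a b c d ∧ N ≤ d ∧ N + d ≤ b ∧ b * ξ - a < c - d * ξ := by
  have refine_twice {a b c d : ℤ} (h : IsFareyPair ξ a b c d) (hlt : b * ξ - a < c - d * ξ) :
      ∃ a' b' c' d', IsFareyPair ξ a' b' c' d' ∧ b + d ≤ d' ∧ b + d' ≤ b' ∧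
        b' * ξ - a' < c' - d' * ξ := by
    obtain ⟨c', d', h', hd, hlt'⟩ := h.exists_right_refinement hξ hlt
    obtain ⟨a', b', h'', hb, hlt''⟩ := h'.exists_left_refinement hξ hlt'
    exact ⟨a', b', c', d', h'', hd, hb, hlt''⟩
  induction N with
  | zero =>
    obtain ⟨a, b, c, d, h, hlt⟩ := exists_isFareyPair_sub_lt_sub hξ
    obtain ⟨a', b', c', d', h', -, hb, hlt'⟩ := refine_twice h hlt
    have := h.left_den_pos
    exact ⟨a', b', c', d', h', by simpa using h'.right_den_pos.le, by push_cast; linarith, hlt'⟩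
  | succ N ih =>
    obtain ⟨a, b, c, d, h, -, hNb, hlt⟩ := ih
    obtain ⟨a', b', c', d', h', hd, hb, hlt'⟩ := refine_twice h hlt
    have := h.right_den_pos
    exact ⟨a', b', c', d', h', by push_cast; linarith, by push_cast; linarith, hlt'⟩

lemma abs_two_mul_sub_sqrt_five_mul_lt {b d x y : ℝ} (hb : 0 < b) (hd : 0 < d)
    (h : d * x + b * y = 1) (hx : 1 / √5 < b * x) (hy : 1 / √5 < d * y) :
    |2 * d - √5 * b| < b := by
  have h5 : √5 ^ 2 = 5 := Real.sq_sqrt (by norm_num)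
  have hsq : b ^ 2 + d ^ 2 < √5 * (b * d) := by
    have hx' := (div_lt_iff₀ (by positivity)).1 hx
    have hy' := (div_lt_iff₀ (by positivity)).1 hy
    calc b ^ 2 + d ^ 2 = d ^ 2 * 1 + b ^ 2 * 1 := by ring
      _ < d ^ 2 * (b * x * √5) + b ^ 2 * (d * y * √5) := by gcongr
      _ = √5 * (b * d) * (d * x + b * y) := by ring
      _ = √5 * (b * d) := by rw [h, mul_one]
  refine abs_lt_of_sq_lt_sq ?_ hb.le
  linear_combination 4 * hsq + b ^ 2 * h5

-- If all three failed, the previous lemma for `(b, d)` and `(b, b + d)` would put both `d / b` and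
-- `1 + d / b` into the open interval `((√5 - 1) / 2, (√5 + 1) / 2)`, which has length `1`.
lemma mul_le_one_div_sqrt_five_or {b d x y : ℝ} (hb : 0 < b) (hd : 0 < d)
    (h : d * x + b * y = 1) :
    b * x ≤ 1 / √5 ∨ d * y ≤ 1 / √5 ∨ (b + d) * (y - x) ≤ 1 / √5 := by
  by_contra! hcon
  obtain ⟨hx, hy, hmed⟩ := hcon
  have h₁ := (abs_lt.1 (abs_two_mul_sub_sqrt_five_mul_lt hb hd h hx hy)).1
  have h₂ := (abs_lt.1 (abs_two_mul_sub_sqrt_five_mul_lt hb (add_pos hb hd)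
    (by linear_combination h) hx hmed)).2
  linarith

theorem frequently_mul_abs_sub_le_one_div_sqrt_five {ξ : ℝ} (hξ : Irrational ξ) :
    ∃ᶠ q : ℤ in atTop, ∃ p : ℤ, q * |q * ξ - p| ≤ 1 / √5 := by
  refine frequently_atTop.2 fun N => ?_
  obtain ⟨a, b, c, d, h, hd, hb, hlt⟩ := exists_isFareyPair_ge hξ N.toNat
  have hN := N.self_le_toNat
  have hd₀ := h.right_den_pos
  rcases mul_le_one_div_sqrt_five_or (Int.cast_pos.2 h.left_den_pos) (Int.cast_pos.2 hd₀)
    h.den_mul_add_den_mul with hle | hle | hle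
  · refine ⟨b, by linarith, a, ?_⟩
    rwa [abs_of_pos (sub_pos.2 h.left_lt)]
  · refine ⟨d, by linarith, c, ?_⟩
    rwa [abs_sub_comm, abs_of_pos (sub_pos.2 h.lt_right)]
  · refine ⟨b + d, by linarith, a + c, ?_⟩
    push_cast
    rwa [abs_sub_comm, abs_of_pos (by linarith),
      show a + c - (b + d) * ξ = c - d * ξ - (b * ξ - a) by ring]

lemma IsFareyPair.exists_even_mul_abs_sub_le_one {ξ : ℝ} {a b c d : ℤ} {N : ℕ}
    (h : IsFareyPair ξ a b c d) (hd : N ≤ d) (hb : N + d ≤ b) (hlt : b * ξ - a < c - d * ξ) :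
    ∃ q ≥ (N : ℤ), Even q ∧ ∃ p : ℤ, Odd p ∧ q * |q * ξ - p| ≤ 1 := by
  have hx : 0 < b * ξ - a := sub_pos.2 h.left_lt
  have hy : 0 < c - d * ξ := sub_pos.2 h.lt_right
  have hb₀ : (0 : ℝ) < b := Int.cast_pos.2 h.left_den_pos
  have hd₀ : (0 : ℝ) < d := Int.cast_pos.2 h.right_den_pos
  have hdb : (d : ℝ) ≤ b := by exact_mod_cast (by linarith : d ≤ b)
  have hone := h.den_mul_add_den_mul
  have hby : b * (c - d * ξ) ≤ 1 := by linarith [mul_pos hd₀ hx]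
  have hparity : Odd b ∧ Odd c ↔ Even a ∨ Even d := by
    rw [← Int.odd_mul, ← Int.even_mul, ← Int.odd_sub, h.det_eq_one]
    exact odd_one
  by_cases hb₂ : Even b
  · refine ⟨b, by linarith, hb₂, a, by grind, ?_⟩
    rw [abs_of_pos hx]
    exact (mul_le_mul_of_nonneg_left hlt.le hb₀.le).trans hby
  by_cases hd₂ : Even d
  · refine ⟨d, hd, hd₂, c, by grind, ?_⟩
    rw [abs_sub_comm, abs_of_pos hy]
    exact (mul_le_mul_of_nonneg_right hdb hy.le).trans hby
  rw [Int.not_even_iff_odd] at hb₂ hd₂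
  have hsum : (b + d) * (c - d * ξ - (b * ξ - a)) + (b - d) * (b * ξ - a + (c - d * ξ)) ≤ 2 := by
    linear_combination 4 * (mul_pos hd₀ hx).le + 2 * hone
  rcases le_or_gt ((b + d) * (c - d * ξ - (b * ξ - a))) 1 with hmed | hmed
  · refine ⟨b + d, by linarith, hb₂.add_odd hd₂, a + c, by grind, ?_⟩
    push_cast
    rwa [abs_sub_comm, abs_of_pos (by linarith),
      show a + c - (b + d) * ξ = c - d * ξ - (b * ξ - a) by ring]
  · refine ⟨b - d, by linarith, hb₂.sub_odd hd₂, a - c, by grind, ?_⟩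
    push_cast
    rw [show (b - d) * ξ - (a - c) = b * ξ - a + (c - d * ξ) by ring, abs_of_pos (by linarith)]
    linarith [hsum]

theorem frequently_two_mul_mul_abs_sub_odd_le_one {ξ : ℝ} (hξ : Irrational ξ) :
    ∃ᶠ n : ℤ in atTop, ∃ p : ℤ, Odd p ∧ 2 * n * |2 * n * ξ - p| ≤ 1 := by
  refine frequently_atTop.2 fun N => ?_
  obtain ⟨a, b, c, d, h, hd, hb, hlt⟩ := exists_isFareyPair_ge hξ (2 * N).toNat
  obtain ⟨q, hq, ⟨n, rfl⟩, p, hp, hle⟩ := h.exists_even_mul_abs_sub_le_one hd hb hlt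
  refine ⟨n, by have := (2 * N).self_le_toNat; linarith, p, hp, ?_⟩
  rwa [← two_mul, Int.cast_mul, Int.cast_ofNat] at hle

lemma frequently_pnat_of_frequently_int {P : ℤ → Prop} (h : ∃ᶠ q : ℤ in atTop, P q) :
    ∃ᶠ n : ℕ+ in atTop, P n := by
  refine frequently_atTop.2 fun N => ?_
  obtain ⟨q, hq, hP⟩ := frequently_atTop.1 h N
  lift q to ℕ using (Int.natCast_nonneg _).trans hq
  exact ⟨⟨q, N.pos.trans_le (Int.ofNat_le.1 hq)⟩, Int.ofNat_le.1 hq, hP⟩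

end FareyPairs

lemma rSeq_eq_sub_round (L L₁ : ℝ) (n : ℕ+) :
    rSeq L L₁ n = L₁ / L * n - round (L₁ / L * n) := by
  rw [rSeq, round_eq]

lemma rSeq_ne_zero {L L₁ : ℝ} (hirr : Irrational (L₁ / L)) (n : ℕ+) : rSeq L L₁ n ≠ 0 :=
  ((hirr.mul_natCast n.ne_zero).sub_intCast _).ne_zero

lemma abs_rSeq_lt_half {L L₁ : ℝ} (hirr : Irrational (L₁ / L)) (n : ℕ+) :
    |rSeq L L₁ n| < 1 / 2 := by
  have hirr' : Irrational |rSeq L L₁ n| := by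
    rcases abs_choice (rSeq L L₁ n) with h | h <;> rw [h]
    · exact (hirr.mul_natCast n.ne_zero).sub_intCast _
    · exact ((hirr.mul_natCast n.ne_zero).sub_intCast _).neg
  refine lt_of_le_of_ne ?_ fun h => hirr' ⟨1 / 2, by rw [h]; norm_num⟩
  rw [rSeq_eq_sub_round]
  exact abs_sub_round _

lemma abs_rSeq_le (L L₁ : ℝ) (n : ℕ+) (p : ℤ) : |rSeq L L₁ n| ≤ |n * (L₁ / L) - p| := by
  rw [rSeq_eq_sub_round, mul_comm]
  exact round_le _ p

lemma one_sub_two_mul_abs_rSeq_le (L L₁ : ℝ) (n : ℕ+) {p : ℤ} (hp : Odd p) :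
    1 - 2 * |rSeq L L₁ n| ≤ |2 * n * (L₁ / L) - p| := by
  set m : ℤ := round (L₁ / L * n)
  have hone : (1 : ℝ) ≤ |((2 * m - p : ℤ) : ℝ)| := by
    have : 2 * m - p ≠ 0 := by grind
    exact_mod_cast Int.one_le_abs this
  have hsplit : ((2 * m - p : ℤ) : ℝ) = (2 * n * (L₁ / L) - p) - 2 * rSeq L L₁ n := by
    rw [rSeq_eq_sub_round]
    push_cast
    ring
  have hnorm : |2 * rSeq L L₁ n| = 2 * |rSeq L L₁ n| := by rw [abs_mul, abs_two]
  rw [hsplit] at hone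
  linarith [abs_sub (2 * n * (L₁ / L) - p) (2 * rSeq L L₁ n)]

theorem frequently_mul_two_mul_abs_rSeq_le {L L₁ : ℝ} (hirr : Irrational (L₁ / L)) :
    ∃ᶠ n : ℕ+ in atTop, n * (2 * |rSeq L L₁ n|) ≤ 2 / √5 := by
  refine (frequently_pnat_of_frequently_int
    (frequently_mul_abs_sub_le_one_div_sqrt_five hirr)).mono ?_
  rintro n ⟨p, hp⟩
  rw [Int.cast_natCast] at hp
  calc n * (2 * |rSeq L L₁ n|) ≤ n * (2 * |n * (L₁ / L) - p|) := by
        have := abs_rSeq_le L L₁ n p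
        gcongr
    _ = 2 * (n * |n * (L₁ / L) - p|) := by ring
    _ ≤ 2 * (1 / √5) := by gcongr
    _ = 2 / √5 := by ring

theorem frequently_mul_one_sub_two_mul_abs_rSeq_le {L L₁ : ℝ} (hirr : Irrational (L₁ / L)) :
    ∃ᶠ n : ℕ+ in atTop, n * (1 - 2 * |rSeq L L₁ n|) ≤ 1 / 2 := by
  refine (frequently_pnat_of_frequently_int
    (frequently_two_mul_mul_abs_sub_odd_le_one hirr)).mono ?_
  rintro n ⟨p, hp, hle⟩
  rw [Int.cast_natCast] at hle
  calc n * (1 - 2 * |rSeq L L₁ n|) ≤ n * |2 * n * (L₁ / L) - p| := by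
        gcongr
        exact one_sub_two_mul_abs_rSeq_le L L₁ n hp
    _ ≤ 1 / 2 := by linarith

lemma abs_mul_sign_self (r : ℝ) : |r| * r.sign = r := by
  rcases lt_trichotomy r 0 with h | rfl | h
  · rw [abs_of_neg h, Real.sign_of_neg h, neg_mul_neg, mul_one]
  · simp
  · rw [abs_of_pos h, Real.sign_of_pos h, mul_one]

section Frequencies

variable {L L₁ : ℝ}

lemma two_mul_abs_rSeq_mem_Ioo (hirr : Irrational (L₁ / L)) (n : ℕ+) :
    2 * |rSeq L L₁ n| ∈ Ioo 0 1 :=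
  ⟨mul_pos two_pos (abs_pos.2 (rSeq_ne_zero hirr n)), by linarith [abs_rSeq_lt_half hirr n]⟩

lemma one_sub_two_mul_abs_rSeq_mem_Ioo (hirr : Irrational (L₁ / L)) (n : ℕ+) :
    1 - 2 * |rSeq L L₁ n| ∈ Ioo 0 1 := by
  obtain ⟨hpos, hlt⟩ := two_mul_abs_rSeq_mem_Ioo hirr n
  exact ⟨sub_pos.2 hlt, sub_lt_self 1 hpos⟩

lemma div_mul_rSeq_add_round (hL : L ≠ 0) (L₁ : ℝ) (n : ℕ+) :
    L / n * rSeq L L₁ n + round (L₁ / L * n) * (L / n) = L₁ := by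
  rw [rSeq_eq_sub_round]
  field_simp
  ring

theorem isFrequencyPlus_iff (hL : 0 < L) (hirr : Irrational (L₁ / L)) (n : ℕ+) (ω : ℝ) :
    IsFrequencyPlus L L₁ n ω ↔ ω = frequency L n (2 * |rSeq L L₁ n|) := by
  refine solvesP_cnoidal_iff hL (two_mul_abs_rSeq_mem_Ioo hirr n) ?_ fun hω => ?_
  · rw [shiftPlus, abs_mul, abs_of_nonneg (by positivity)]
    field_simp
    ring
  set s := shiftPlus L L₁ n with hs
  -- Modulo the period `L / n`, the points `0` and `L₁` are symmetric about the maximum point `s`.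
  have hL₁ : L₁ = 2 * s + round (L₁ / L * n) * (L / n) := by
    rw [hs, shiftPlus]
    linear_combination -div_mul_rSeq_add_round hL.ne' L₁ n
  calc cnoidal L n ω s 0 = cnoidal L n ω s (2 * s) := by
        rw [← cnoidal_two_mul_sub hL hω, sub_zero]
    _ = cnoidal L n ω s (2 * s + round (L₁ / L * n) * (L / n)) :=
        ((periodic_cnoidal hL hω n s).int_mul _ _).symm
    _ = 1 * cnoidal L n ω s L₁ := by rw [← hL₁, one_mul]

theorem isFrequencyMinus_iff (hL : 0 < L) (hirr : Irrational (L₁ / L)) (n : ℕ+) (ω : ℝ) :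
    IsFrequencyMinus L L₁ n ω ↔ ω = frequency L n (1 - 2 * |rSeq L L₁ n|) := by
  have hsign := Real.sign_apply_eq_of_ne_zero _ (rSeq_ne_zero hirr n)
  set e := Real.sign (rSeq L L₁ n)
  have habs : |rSeq L L₁ n| * e = rSeq L L₁ n := abs_mul_sign_self _
  refine solvesP_cnoidal_iff hL (one_sub_two_mul_abs_rSeq_mem_Ioo hirr n) ?_ fun hω => ?_
  · have he_abs : |e| = 1 := by rcases hsign with h | h <;> rw [h] <;> norm_num
    rw [shiftMinus, abs_mul, he_abs, abs_mul, abs_of_nonneg (by positivity), abs_sub_comm,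
      abs_of_pos (sub_pos.2 (abs_rSeq_lt_half hirr n))]
    field_simp
    ring
  set s := shiftMinus L L₁ n with hs
  -- Compared with `(P₊)`, moving the maximum point by `L / 4n` moves its reflection by half a
  -- period.
  have hL₁ : L₁ = 2 * s + e * (L / (2 * n)) + round (L₁ / L * n) * (L / n) := by
    rw [hs, shiftMinus]
    linear_combination -div_mul_rSeq_add_round hL.ne' L₁ n - L / n * habs
  have hanti := antiperiodic_cnoidal hL hω n s
  calc cnoidal L n ω s 0 = cnoidal L n ω s (2 * s) := by
        rw [← cnoidal_two_mul_sub hL hω, sub_zero]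
    _ = -1 * cnoidal L n ω s (2 * s + e * (L / (2 * n))) := by
        rw [neg_one_mul]
        rcases hsign with h | h <;> rw [h]
        · rw [neg_one_mul, ← sub_eq_add_neg, hanti.sub_eq, neg_neg]
        · rw [one_mul, hanti, neg_neg]
    _ = -1 * cnoidal L n ω s (2 * s + e * (L / (2 * n)) + round (L₁ / L * n) * (L / n)) := by
        rw [(periodic_cnoidal hL hω n s).int_mul]
    _ = -1 * cnoidal L n ω s L₁ := by rw [← hL₁]

end Frequencies

section Asymptotics

variable {L C : ℝ}

lemma monotoneOn_frequency (hL : 0 < L) (n : ℕ+) : MonotoneOn (frequency L n) (Ioo 0 1) := by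
  intro θ hθ η hη h
  have hθ_mem := matchModulus_mem_Ioo hθ
  have hη_mem := matchModulus_mem_Ioo hη
  have hS : periodS (matchModulus η) ≤ periodS (matchModulus θ) :=
    strictMonoOn_periodS.monotoneOn (Ioo_subset_Ico_self hη_mem) (Ioo_subset_Ico_self hθ_mem)
      (strictAntiOn_matchModulus.antitoneOn hθ hη h)
  have := periodS_pos hη_mem
  rw [frequency, frequency]
  gcongr

lemma tendsto_pnat_cast_atTop : Tendsto (fun n : ℕ+ => (n : ℝ)) atTop atTop :=
  tendsto_natCast_atTop_atTop.comp tendsto_PNat_val_atTop_atTop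

lemma tendsto_frequency_atBot (hL : 0 < L) {θ : ℝ} (hθ : θ ∈ Ioo 0 1) :
    Tendsto (fun n => frequency L n θ) atTop atBot := by
  have := periodS_pos (matchModulus_mem_Ioo hθ)
  refine tendsto_neg_atTop_atBot.comp ((tendsto_pow_atTop two_ne_zero).comp ?_)
  exact (tendsto_pnat_cast_atTop.atTop_mul_const this).atTop_div_const hL

lemma tendsto_zero_atTop_inf_principal {a : ℕ+ → ℝ} (ha : ∀ n, 0 ≤ a n) (C : ℝ) :
    Tendsto a (atTop ⊓ 𝓟 {n | n * a n ≤ C}) (𝓝 0) := by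
  refine squeeze_zero' (Eventually.of_forall ha) (eventually_inf_principal.2 ?_)
    ((tendsto_pnat_cast_atTop.const_div_atTop C).mono_left inf_le_left)
  refine Eventually.of_forall fun n hn => ?_
  rwa [le_div_iff₀' (by positivity)]

theorem not_bddBelow_frequency (hL : 0 < L) {θ : ℕ+ → ℝ} (hθ : ∀ n, θ n ∈ Ioo 0 1)
    (h : ∃ᶠ n : ℕ+ in atTop, n * θ n ≤ C) :
    ¬BddBelow (range fun n => frequency L n (θ n)) := by
  have hhalf : (1 / 2 : ℝ) ∈ Ioo 0 1 := ⟨one_half_pos, one_half_lt_one⟩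
  have hne : NeBot (atTop ⊓ 𝓟 {n : ℕ+ | n * θ n ≤ C}) := frequently_iff_neBot.1 h
  have hθ₀ := tendsto_zero_atTop_inf_principal (fun n => (hθ n).1.le) C
  refine not_bddBelow_of_tendsto_atBot (l := atTop ⊓ 𝓟 {n | n * θ n ≤ C}) <|
    tendsto_atBot_mono' _ ?_ ((tendsto_frequency_atBot hL hhalf).mono_left inf_le_left)
  filter_upwards [hθ₀.eventually (gt_mem_nhds one_half_pos)] with n hn
  exact monotoneOn_frequency hL n (hθ n) hhalf hn.le

lemma neg_sq_le_frequency (hL : 0 < L) {n : ℕ+} {θ : ℝ} (hθ : θ ∈ Ioo 0 1)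
    (h : n * (1 - θ) ≤ C) :
    -(C * (4 * matchModulus θ ^ 2 * ellipticK (matchModulus θ) ^ 2) / L) ^ 2 ≤
      frequency L n θ := by
  have hS := periodS_le (matchModulus_mem_Ioo hθ)
  have hS_pos := periodS_pos (matchModulus_mem_Ioo hθ)
  rw [matchRatio_matchModulus hθ] at hS
  rw [frequency, neg_le_neg_iff]
  refine pow_le_pow_left₀ (by positivity) (div_le_div_of_nonneg_right ?_ hL.le) 2
  calc (n : ℝ) * periodS (matchModulus θ)
      ≤ n * (4 * matchModulus θ ^ 2 * ellipticK (matchModulus θ) ^ 2 * (1 - θ)) := by gcongr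
    _ = n * (1 - θ) * (4 * matchModulus θ ^ 2 * ellipticK (matchModulus θ) ^ 2) := by ring
    _ ≤ _ := by gcongr

lemma tendsto_neg_sq_matchModulus (C L : ℝ) :
    Tendsto (fun θ => -(C * (4 * matchModulus θ ^ 2 * ellipticK (matchModulus θ) ^ 2) / L) ^ 2)
      (𝓝[<] 1) (𝓝 (-(C * (2 * ellipticK (1 / √2) ^ 2) / L) ^ 2)) := by
  have hk : Tendsto matchModulus (𝓝[<] 1) (𝓝 (1 / √2)) :=
    tendsto_matchModulus.mono_right nhdsWithin_le_nhds
  have hmem : 1 / √2 ∈ Ioo (-1 : ℝ) 1 :=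
    ⟨neg_one_lt_zero.trans (by positivity), one_div_sqrt_two_lt_one⟩
  have hK : Tendsto (fun θ => ellipticK (matchModulus θ)) (𝓝[<] 1) (𝓝 (ellipticK (1 / √2))) :=
    (continuousOn_ellipticK.continuousAt (isOpen_Ioo.mem_nhds hmem)).tendsto.comp hk
  have hlim := (((((hk.pow 2).const_mul 4).mul (hK.pow 2)).const_mul C).div_const L).pow 2 |>.neg
  rwa [one_div_sqrt_two_sq, show (4 : ℝ) * (1 / 2) = 2 by norm_num] at hlim

lemma exists_mapClusterPt_mem_Icc {ι : Type*} {l : Filter ι} [NeBot l] {u b : ι → ℝ} {B M : ℝ}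
    (hb : Tendsto b l (𝓝 B)) (h : ∀ᶠ i in l, u i ∈ Icc (b i) M) :
    ∃ x ∈ Icc B M, MapClusterPt x l u := by
  have hmem : ∀ᶠ i in l, u i ∈ Icc (B - 1) M := by
    filter_upwards [h, hb.eventually (lt_mem_nhds (sub_one_lt B))] with i hi hBi
    exact ⟨hBi.le.trans hi.1, hi.2⟩
  have hle : Ultrafilter.of l ≤ l := Ultrafilter.of_le l
  obtain ⟨x, hx, hlim⟩ := isCompact_Icc.ultrafilter_le_nhds ((Ultrafilter.of l).map u)
    (le_principal_iff.2 (hle hmem))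
  have hux : Tendsto u (Ultrafilter.of l) (𝓝 x) := hlim
  refine ⟨x, ⟨?_, hx.2⟩, hux.mapClusterPt.mono hle⟩
  exact le_of_tendsto_of_tendsto (hb.mono_left hle) hux (hle (h.mono fun i hi => hi.1))

theorem exists_mapClusterPt_frequency (hL : 0 < L) {θ : ℕ+ → ℝ} (hθ : ∀ n, θ n ∈ Ioo 0 1)
    (h : ∃ᶠ n : ℕ+ in atTop, n * (1 - θ n) ≤ C) :
    ∃ x ∈ Icc (-(C * (2 * ellipticK (1 / √2) ^ 2) / L) ^ 2) 0,
      MapClusterPt x atTop fun n => frequency L n (θ n) := by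
  have hne : NeBot (atTop ⊓ 𝓟 {n : ℕ+ | n * (1 - θ n) ≤ C}) := frequently_iff_neBot.1 h
  have hθ₁ : Tendsto θ (atTop ⊓ 𝓟 {n | n * (1 - θ n) ≤ C}) (𝓝[<] 1) := by
    refine tendsto_nhdsWithin_iff.2 ⟨?_, Eventually.of_forall fun n => (hθ n).2⟩
    simpa using
      (tendsto_zero_atTop_inf_principal (fun n => sub_nonneg.2 (hθ n).2.le) C).const_sub 1
  obtain ⟨x, hx, hcluster⟩ := exists_mapClusterPt_mem_Icc
    ((tendsto_neg_sq_matchModulus C L).comp hθ₁) <| eventually_inf_principal.2 <|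
      Eventually.of_forall fun n hn =>
        ⟨neg_sq_le_frequency hL (hθ n) hn, (frequency_neg hL n (hθ n)).le⟩
  exact ⟨x, hx, hcluster.mono inf_le_left⟩

end Asymptotics

theorem theorem3_general (L₁ L : ℝ) (hL : 0 < L) (hirr : Irrational (L₁ / L)) :
    ∃ ωp ωm : ℕ+ → ℝ,
      (∀ (n : ℕ+) (ω : ℝ), IsFrequencyPlus L L₁ n ω ↔ ω = ωp n) ∧
      (∀ (n : ℕ+) (ω : ℝ), IsFrequencyMinus L L₁ n ω ↔ ω = ωm n) ∧
      ¬ BddBelow (range ωp) ∧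
      ¬ BddBelow (range ωm) ∧
      (∃ x ∈ Icc (-(1 / L ^ 2 * ellipticK (1 / √2) ^ 4)) 0, MapClusterPt x atTop ωp) ∧
      (∃ x ∈ Icc (-(16 / (5 * L ^ 2) * ellipticK (1 / √2) ^ 4)) 0, MapClusterPt x atTop ωm) := by
  have hzero := frequently_mul_two_mul_abs_rSeq_le hirr
  have hhalf := frequently_mul_one_sub_two_mul_abs_rSeq_le hirr
  have hθp := two_mul_abs_rSeq_mem_Ioo hirr
  have hθm := one_sub_two_mul_abs_rSeq_mem_Ioo hirr
  refine ⟨fun n => frequency L n (2 * |rSeq L L₁ n|),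
    fun n => frequency L n (1 - 2 * |rSeq L L₁ n|),
    isFrequencyPlus_iff hL hirr, isFrequencyMinus_iff hL hirr,
    not_bddBelow_frequency hL hθp hzero, not_bddBelow_frequency hL hθm hhalf, ?_, ?_⟩
  · convert exists_mapClusterPt_frequency hL hθp hhalf using 5
    field_simp
  · convert exists_mapClusterPt_frequency (C := 2 / √5) hL hθm (by simpa using hzero) using 5
    rw [div_pow, mul_pow, div_pow, Real.sq_sqrt (by norm_num : (0 : ℝ) ≤ 5)]
    field_simp
    ring

theorem theorem3 (L₁ L₂ L : ℝ) (hL₁ : 0 < L₁) (hL₂ : L₁ ≤ L₂) (hL : L = L₁ + L₂)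
    (hirr : Irrational (L₁ / L)) :
    ∃ ωp ωm : ℕ+ → ℝ,
      (∀ (n : ℕ+) (ω : ℝ), IsFrequencyPlus L L₁ n ω ↔ ω = ωp n) ∧
      (∀ (n : ℕ+) (ω : ℝ), IsFrequencyMinus L L₁ n ω ↔ ω = ωm n) ∧
      ¬ BddBelow (range ωp) ∧
      ¬ BddBelow (range ωm) ∧
      (∃ x ∈ Icc (-(1 / L ^ 2 * ellipticK (1 / √2) ^ 4)) 0, MapClusterPt x atTop ωp) ∧
      (∃ x ∈ Icc (-(16 / (5 * L ^ 2) * ellipticK (1 / √2) ^ 4)) 0, MapClusterPt x atTop ωm) :=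
  theorem3_general L₁ L (by linarith) hirr
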